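/- Let $d\ge 1$ and let $\Phi_\alpha(x)=\prod_{j=1}^d h_{\alpha_j}(x_j)$, $\alpha\in\mathbb N^d$ (where $\mathbb N=\{0,1,2,\dots\}$), be the normalized Hermite functions on $\mathbb R^d$, where $h_k(x)=(\sqrt\pi\,2^k k!)^{-1/2}(-1)^k e^{x^2/2}\frac{d^k}{dx^k}e^{-x^2}$. Let $H=-\Delta+|x|^2$ be the Hermite operator, for which $H\Phi_\alpha=(2|\alpha|+d)\Phi_\alpha$ with $|\alpha|=\alpha_1+\dots+\alpha_d$, and for $t>0$ and $f\in L^p(\mathbb R^d)$, $1\le p\le\infty$, complex-valued, let $$e^{-tH}f=\sum_{\alpha\in\mathbb N^d}e^{-t(2|\alpha|+d)}\langle f,\Phi_\alpha\rangle\,\Phi_\alpha,\qquad \langle f,\Phi_\alpha\rangle=\int_{\mathbb R^d}f\,\Phi_\alpha\,dx.$$ There the integrals and, at every point $x\in\mathbb R^d$, the series converge absolutely; if $f\in L^2(\mathbb R^d)$, the series also converges to $e^{-tH}f$ in $L^2(\mathbb R^d)$. There is a constant $C>0$ depending only on $d$ such that for all $1\le p,q\le\infty$, all $t>0$ and all $f\in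 L^p(\mathbb R^d)$ one has $e^{-tH}f\in L^q(\mathbb R^d)$ and $$\|e^{-tH}f\|_{L^q}\le C\,(\tanh t)^{-\frac d2\left|\frac1q-\frac1p\right|}\,\|f\|_{L^p}$$ (with $1/\infty=0$). -/

import Mathlib

open MeasureTheory Filter Topology
open scoped ENNReal

noncomputable section

/-- The normalized one-dimensional Hermite function
`h_k(x) = (√π 2^k k!)^(-1/2) (-1)^k e^(x²/2) (d^k/dx^k) e^(-x²)`. -/
def hermiteFun (k : ℕ) (x : ℝ) : ℝ :=
  (Real.sqrt Real.pi * 2 ^ k * (k.factorial : ℝ)) ^ (-(1 / 2) : ℝ) * (-1) ^ k *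
    Real.exp (x ^ 2 / 2) * iteratedDeriv k (fun y : ℝ => Real.exp (-y ^ 2)) x

/-- The normalized `d`-dimensional Hermite function `Φ_α(x) = ∏ j, h_{α_j}(x_j)`. -/
def hermitePhi {d : ℕ} (α : Fin d → ℕ) (x : EuclideanSpace ℝ (Fin d)) : ℝ :=
  ∏ j, hermiteFun (α j) (x j)

/-- The Hermite coefficient `⟨f, Φ_α⟩ = ∫ f Φ_α` (`Φ_α` is real-valued). -/
def hermiteCoeff {d : ℕ} (f : EuclideanSpace ℝ (Fin d) → ℂ) (α : Fin d → ℕ) : ℂ :=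
  ∫ x, f x * (hermitePhi α x : ℂ)

/-- The term `e^{-t(2|α|+d)} ⟨f, Φ_α⟩ Φ_α(x)` of the spectral expansion of `e^{-tH} f`;
`2|α|+d` is the eigenvalue of `H = -Δ + |x|²` on `Φ_α`. -/
def hermiteHeatTerm {d : ℕ} (t : ℝ) (f : EuclideanSpace ℝ (Fin d) → ℂ) (α : Fin d → ℕ)
    (x : EuclideanSpace ℝ (Fin d)) : ℂ :=
  (Real.exp (-t * (2 * ((∑ j, α j : ℕ) : ℝ) + (d : ℝ))) : ℂ) * hermiteCoeff f α *
    (hermitePhi α x : ℂ)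

/-- The Hermite heat semigroup `e^{-tH} f = ∑_α e^{-t(2|α|+d)} ⟨f, Φ_α⟩ Φ_α`. -/
def hermiteHeat {d : ℕ} (t : ℝ) (f : EuclideanSpace ℝ (Fin d) → ℂ)
    (x : EuclideanSpace ℝ (Fin d)) : ℂ :=
  ∑' α : Fin d → ℕ, hermiteHeatTerm t f α x

end

/-! ### Fourier representation of Hermite functions -/

section HermiteFourier

open Complex FourierTransform

/-! The operator `e^{-tH}` is integration against Mehler's kernel `K`, an explicit Gaussian in `x +
y` and `x - y` with parameter `τ = tanh t`. For Mehler's formula (`hasSum_mehler`), write the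
derivatives of `e^{-x²}` as Fourier integrals: `h_k(x) h_k(y)` becomes a double integral containing
`(-2π²uv)^k / k!`, so the sum over `k` is an exponential series and a Gaussian integral remains.
Taking products over coordinates gives `hasSum_mehlerKernel`.

With `A = (8π)^{d/2}` and `N = τ^{-d/2}`, the Gaussian bound `mehlerKernel_le` yields `∫ K(x,y) dy ≤
A`, `K ≤ A N` and `∬ K ≤ A N`: the `L^p → L^p`, `L^1 → L^∞` and `L^∞ → L^1` bounds. Two uses of
Hölder (`eLpNorm_le_of_enorm_le_lintegral_kernel`) interpolate between them with norm `A N^{|1/q -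
1/p|}`; no complex interpolation is needed.

Convergence of the expansion also comes from the kernel: every term of the diagonal series is
nonnegative, hence at most `K(x,x)`, and this bounds each `Φ_α` by a Gaussian (`abs_hermitePhi_le`).
-/

lemma iteratedDeriv_ofReal_comp {f : ℝ → ℝ} (hf : ContDiff ℝ ⊤ f) (n : ℕ) (x : ℝ) :
    iteratedDeriv n (fun y => (f y : ℂ)) x = ((iteratedDeriv n f x : ℝ) : ℂ) := by
  induction n generalizing x with
  | zero => simp
  | succ n ih =>
    rw [iteratedDeriv_succ, iteratedDeriv_succ, funext ih]
    have h : DifferentiableAt ℝ (iteratedDeriv n f) x :=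
      (hf.differentiable_iteratedDeriv n (WithTop.coe_lt_top _)).differentiableAt
    exact h.hasDerivAt.ofReal_comp.deriv

lemma integrable_pow_mul_gaussian (n : ℕ) {b : ℝ} (hb : 0 < b) :
    Integrable (fun x : ℝ => x ^ n * Real.exp (-b * x ^ 2)) := by
  have := integrable_rpow_mul_exp_neg_mul_sq hb (s := n) (by linarith [n.cast_nonneg (α := ℝ)])
  simpa using this

lemma exp_neg_sq_eq_fourier :
    (fun x : ℝ => ((Real.exp (-x ^ 2) : ℝ) : ℂ)) =
      fun x => (Real.sqrt Real.pi : ℂ) *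
        𝓕 (fun u : ℝ => ((Real.exp (-Real.pi ^ 2 * u ^ 2) : ℝ) : ℂ)) x := by
  have h := fourier_gaussian_pi (b := (Real.pi : ℂ)) (by simpa using Real.pi_pos)
  have e : (fun u : ℝ => ((Real.exp (-Real.pi ^ 2 * u ^ 2) : ℝ) : ℂ)) =
      fun x : ℝ => cexp (-Real.pi * Real.pi * x ^ 2) := by
    ext u; push_cast; ring_nf
  rw [e, h]
  ext x
  have hp : (Real.pi : ℂ) ≠ 0 := by exact_mod_cast Real.pi_ne_zero
  have h2 : (Real.sqrt Real.pi : ℂ) = (Real.pi : ℂ) ^ (1 / 2 : ℂ) := by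
    rw [Real.sqrt_eq_rpow, Complex.ofReal_cpow Real.pi_pos.le]; push_cast; rfl
  rw [← h2, ← mul_assoc, mul_one_div_cancel, neg_div, div_self hp]
  · push_cast; ring_nf
  · exact_mod_cast (Real.sqrt_pos.2 Real.pi_pos).ne'

/-- Each derivative of a Fourier transform puts a factor `-2πiu` under the integral. -/
lemma iteratedDeriv_exp_neg_sq (k : ℕ) (x : ℝ) :
    ((iteratedDeriv k (fun y : ℝ => Real.exp (-y ^ 2)) x : ℝ) : ℂ) =
      Real.sqrt Real.pi * ∫ u : ℝ, (-2 * Real.pi * I * u) ^ k *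
        cexp (-Real.pi ^ 2 * u ^ 2 - 2 * Real.pi * I * u * x) := by
  rw [← iteratedDeriv_ofReal_comp (by fun_prop), exp_neg_sq_eq_fourier,
    iteratedDeriv_const_mul_field, Real.iteratedDeriv_fourier (N := ⊤) _ (by simp),
    Real.fourier_eq']
  · congr 2
    ext u
    simp only [smul_eq_mul]
    rw [mul_left_comm, Complex.ofReal_exp, ← Complex.exp_add]
    congr 2
    simp
    ring
  · intro n _
    have := (integrable_pow_mul_gaussian n (b := Real.pi ^ 2) (by positivity)).ofReal (𝕜 := ℂ)
    simpa using this

/-- The squared normalization contributes `1 / (2^k k!)`, and `(-2πi)² / 2 = -2π²`; the integrand is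
thus a term of an exponential series in `z.1 * z.2`. -/
lemma hermiteFun_mul_hermiteFun (k : ℕ) (x y : ℝ) :
    ((hermiteFun k x * hermiteFun k y : ℝ) : ℂ) =
      Real.sqrt Real.pi * cexp ((x ^ 2 + y ^ 2) / 2) *
        ∫ z : ℝ × ℝ, (-2 * Real.pi ^ 2 * z.1 * z.2) ^ k / k.factorial *
          (cexp (-Real.pi ^ 2 * z.1 ^ 2 - 2 * Real.pi * I * z.1 * x) *
            cexp (-Real.pi ^ 2 * z.2 ^ 2 - 2 * Real.pi * I * z.2 * y)) := by
  have e : ∀ z : ℝ × ℝ, (-2 * (Real.pi : ℂ) ^ 2 * z.1 * z.2) ^ k / k.factorial *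
          (cexp (-Real.pi ^ 2 * z.1 ^ 2 - 2 * Real.pi * I * z.1 * x) *
            cexp (-Real.pi ^ 2 * z.2 ^ 2 - 2 * Real.pi * I * z.2 * y)) =
      (2 ^ k * k.factorial : ℂ)⁻¹ * (((-2 * Real.pi * I * z.1) ^ k *
        cexp (-Real.pi ^ 2 * z.1 ^ 2 - 2 * Real.pi * I * z.1 * x)) *
        ((-2 * Real.pi * I * z.2) ^ k *
        cexp (-Real.pi ^ 2 * z.2 ^ 2 - 2 * Real.pi * I * z.2 * y))) := by
    intro z
    have h : (-2 * (Real.pi : ℂ) ^ 2 * z.1 * z.2) ^ k * 2 ^ k =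
        (-2 * Real.pi * I * z.1) ^ k * (-2 * Real.pi * I * z.2) ^ k := by
      rw [← mul_pow, ← mul_pow]
      congr 1
      linear_combination (-4 * (Real.pi : ℂ) ^ 2 * z.1 * z.2) * Complex.I_sq
    have hk : (k.factorial : ℂ) ≠ 0 := by exact_mod_cast k.factorial_ne_zero
    have h2 : (2 : ℂ) ^ k ≠ 0 := pow_ne_zero _ two_ne_zero
    rw [mul_mul_mul_comm, ← h]
    field_simp
  simp_rw [e]
  rw [integral_const_mul, Measure.volume_eq_prod,
    integral_prod_mul (f := fun u : ℝ => (-2 * Real.pi * I * u) ^ k *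
        cexp (-Real.pi ^ 2 * u ^ 2 - 2 * Real.pi * I * u * x))
      (g := fun u : ℝ => (-2 * Real.pi * I * u) ^ k *
        cexp (-Real.pi ^ 2 * u ^ 2 - 2 * Real.pi * I * u * y))]
  have hx := iteratedDeriv_exp_neg_sq k x
  have hy := iteratedDeriv_exp_neg_sq k y
  unfold hermiteFun
  set X := iteratedDeriv k (fun y : ℝ => Real.exp (-y ^ 2)) x
  set Y := iteratedDeriv k (fun y : ℝ => Real.exp (-y ^ 2)) y
  generalize (∫ u : ℝ, (-2 * (Real.pi : ℂ) * I * u) ^ k *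
        cexp (-Real.pi ^ 2 * u ^ 2 - 2 * Real.pi * I * u * x)) = U at *
  generalize (∫ u : ℝ, (-2 * (Real.pi : ℂ) * I * u) ^ k *
        cexp (-Real.pi ^ 2 * u ^ 2 - 2 * Real.pi * I * u * y)) = V at *
  set s := Real.sqrt Real.pi with hs
  have hs0 : 0 < s := Real.sqrt_pos.2 Real.pi_pos
  set c := (s * 2 ^ k * (k.factorial : ℝ)) ^ (-(1 / 2) : ℝ) with hc
  have hc2 : c * c = s⁻¹ * (2 ^ k * (k.factorial : ℝ))⁻¹ := by
    rw [hc, ← Real.rpow_add (by positivity)]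
    norm_num
    rw [Real.rpow_neg_one]
    ring
  have hsign : ((-1 : ℝ) ^ k) * (-1) ^ k = 1 := by rw [← mul_pow]; simp
  have hexp : Real.exp (x ^ 2 / 2) * Real.exp (y ^ 2 / 2) = Real.exp ((x ^ 2 + y ^ 2) / 2) := by
    rw [← Real.exp_add]; ring_nf
  have h1 : c * (-1) ^ k * Real.exp (x ^ 2 / 2) * X * (c * (-1) ^ k * Real.exp (y ^ 2 / 2) * Y) =
      s⁻¹ * (2 ^ k * (k.factorial : ℝ))⁻¹ * Real.exp ((x ^ 2 + y ^ 2) / 2) * X * Y := by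
    rw [← hexp, ← hc2]
    linear_combination (c * c * Real.exp (x ^ 2 / 2) * X * (Real.exp (y ^ 2 / 2) * Y)) * hsign
  rw [h1]
  push_cast
  rw [hx, hy]
  have : (s : ℂ) ≠ 0 := by exact_mod_cast hs0.ne'
  field_simp

end HermiteFourier

/-! ### Mehler's formula in one dimension -/

section Mehler

open Complex

lemma integrable_prod_gaussian {b : ℝ} (hb : 0 < b) :
    Integrable (fun z : ℝ × ℝ => Real.exp (-b * (z.1 ^ 2 + z.2 ^ 2))) := by
  have h := (integrable_exp_neg_mul_sq hb).mul_prod (integrable_exp_neg_mul_sq hb)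
  rw [← Measure.volume_eq_prod] at h
  refine h.congr (ae_of_all _ fun z => ?_)
  simp only
  rw [← Real.exp_add]; ring_nf

lemma norm_mehlerTerm (k : ℕ) (x y r : ℝ) (hr : 0 ≤ r) (z : ℝ × ℝ) :
    ‖(r : ℂ) ^ k * ((-2 * Real.pi ^ 2 * z.1 * z.2) ^ k / k.factorial *
          (cexp (-Real.pi ^ 2 * z.1 ^ 2 - 2 * Real.pi * I * z.1 * x) *
            cexp (-Real.pi ^ 2 * z.2 ^ 2 - 2 * Real.pi * I * z.2 * y)))‖ =
      (2 * Real.pi ^ 2 * r * |z.1| * |z.2|) ^ k / k.factorial *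
        Real.exp (-Real.pi ^ 2 * (z.1 ^ 2 + z.2 ^ 2)) := by
  have h (u v : ℝ) : ‖cexp (-Real.pi ^ 2 * u ^ 2 - 2 * Real.pi * I * u * v)‖ =
      Real.exp (-Real.pi ^ 2 * u ^ 2) := by
    rw [Complex.norm_exp]
    congr 1
    simp [← Complex.ofReal_pow]
  rw [norm_mul, norm_mul, norm_mul, h, h, ← Real.exp_add, norm_div, norm_pow, norm_pow]
  simp only [norm_mul, norm_neg, norm_pow, Complex.norm_real, Real.norm_eq_abs, abs_of_nonneg hr,
    Complex.norm_natCast, abs_of_pos Real.pi_pos, Complex.norm_ofNat]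
  rw [← mul_assoc, ← mul_div_assoc, ← mul_pow]
  ring_nf

lemma gaussian_fourier_integral {c : ℝ} (hc : 0 < c) (w : ℂ) :
    ∫ u : ℝ, cexp (-c * u ^ 2 + w * u) =
      ((Real.sqrt (Real.pi / c) : ℝ) : ℂ) * cexp (w ^ 2 / (4 * c)) := by
  have := integral_cexp_quadratic (b := -(c : ℂ)) (by simpa using hc) w 0
  simp only [add_zero] at this
  rw [this, neg_neg, Real.sqrt_eq_rpow, Complex.ofReal_cpow (by positivity)]
  push_cast
  congr 2
  field_simp
  ring

lemma integral_mehler {r : ℝ} (hr : 0 < r) (hr1 : r < 1) (x y : ℝ)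
    (hint : Integrable (fun z : ℝ × ℝ => cexp (-2 * Real.pi ^ 2 * r * z.1 * z.2) *
        (cexp (-Real.pi ^ 2 * z.1 ^ 2 - 2 * Real.pi * I * z.1 * x) *
          cexp (-Real.pi ^ 2 * z.2 ^ 2 - 2 * Real.pi * I * z.2 * y)))) :
    ∫ z : ℝ × ℝ, cexp (-2 * Real.pi ^ 2 * r * z.1 * z.2) *
        (cexp (-Real.pi ^ 2 * z.1 ^ 2 - 2 * Real.pi * I * z.1 * x) *
          cexp (-Real.pi ^ 2 * z.2 ^ 2 - 2 * Real.pi * I * z.2 * y)) =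
      ((Real.sqrt (Real.pi)⁻¹ * Real.sqrt (Real.pi * (1 - r ^ 2))⁻¹ *
        Real.exp (-y ^ 2 - (x - r * y) ^ 2 / (1 - r ^ 2)) : ℝ) : ℂ) := by
  have hp := Real.pi_pos
  have hpc : (Real.pi : ℂ) ≠ 0 := by exact_mod_cast hp.ne'
  have h1 : 0 < 1 - r ^ 2 := by nlinarith
  have h1c : (1 - (r : ℂ) ^ 2) ≠ 0 := by exact_mod_cast h1.ne'
  rw [Measure.volume_eq_prod, integral_prod _ (by rwa [← Measure.volume_eq_prod])]
  -- Completing the square in `v` returns `π²r²u²` to the exponent, so a Gaussian in `u` with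
  -- coefficient `π²(1 - r²)` is left.
  have inner : ∀ u : ℝ, ∫ v : ℝ, cexp (-2 * Real.pi ^ 2 * r * u * v) *
        (cexp (-Real.pi ^ 2 * u ^ 2 - 2 * Real.pi * I * u * x) *
          cexp (-Real.pi ^ 2 * v ^ 2 - 2 * Real.pi * I * v * y)) =
      (Real.sqrt (Real.pi)⁻¹ : ℂ) * cexp (-y ^ 2) *
        cexp (-((Real.pi ^ 2 * (1 - r ^ 2) : ℝ) : ℂ) * u ^ 2 +
          (2 * Real.pi * I * (r * y - x)) * u) := by
    intro u
    have e : ∀ v : ℝ, cexp (-2 * Real.pi ^ 2 * r * u * v) *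
        (cexp (-Real.pi ^ 2 * u ^ 2 - 2 * Real.pi * I * u * x) *
          cexp (-Real.pi ^ 2 * v ^ 2 - 2 * Real.pi * I * v * y)) =
        cexp (-Real.pi ^ 2 * u ^ 2 - 2 * Real.pi * I * u * x) *
          cexp (-((Real.pi ^ 2 : ℝ) : ℂ) * v ^ 2 +
            (-2 * Real.pi ^ 2 * r * u - 2 * Real.pi * I * y) * v) := by
      intro v
      rw [← Complex.exp_add, ← Complex.exp_add, ← Complex.exp_add]
      push_cast
      congr 1
      ring
    simp_rw [e]
    rw [integral_const_mul, gaussian_fourier_integral (by positivity)]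
    have hq : Real.pi / Real.pi ^ 2 = Real.pi⁻¹ := by field_simp
    rw [hq, mul_left_comm, mul_assoc (_ : ℂ) (cexp _), ← Complex.exp_add, ← Complex.exp_add]
    congr 2
    push_cast
    field_simp
    ring_nf
    simp only [Complex.I_sq]
    ring
  simp_rw [inner]
  rw [integral_const_mul, gaussian_fourier_integral (by positivity)]
  have hq : Real.pi / (Real.pi ^ 2 * (1 - r ^ 2)) = (Real.pi * (1 - r ^ 2))⁻¹ := by
    field_simp
  rw [hq]
  push_cast
  rw [sub_eq_add_neg (-(y : ℂ) ^ 2), Complex.exp_add]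
  have : (2 * (Real.pi : ℂ) * I * (r * y - x)) ^ 2 / (4 * (Real.pi ^ 2 * (1 - r ^ 2))) =
      -((x - r * y) ^ 2 / (1 - r ^ 2)) := by
    field_simp
    ring_nf
    simp only [Complex.I_sq]
    ring
  rw [this]
  ring

/-- **Mehler's formula** for the Hermite functions on the line. -/
theorem hasSum_mehler {r : ℝ} (hr : 0 < r) (hr1 : r < 1) (x y : ℝ) :
    HasSum (fun k : ℕ => r ^ k * (hermiteFun k x * hermiteFun k y))
      (Real.sqrt (Real.pi * (1 - r ^ 2))⁻¹ *
        Real.exp ((x ^ 2 + y ^ 2) / 2 - y ^ 2 - (x - r * y) ^ 2 / (1 - r ^ 2))) := by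
  set W : ℝ × ℝ → ℂ := fun z =>
        (cexp (-Real.pi ^ 2 * z.1 ^ 2 - 2 * Real.pi * I * z.1 * x) *
          cexp (-Real.pi ^ 2 * z.2 ^ 2 - 2 * Real.pi * I * z.2 * y)) with hW
  have hsum : ∀ z : ℝ × ℝ, HasSum (fun k : ℕ =>
      (r : ℂ) ^ k * ((-2 * Real.pi ^ 2 * z.1 * z.2) ^ k / k.factorial * W z))
      (cexp (-2 * Real.pi ^ 2 * r * z.1 * z.2) * W z) := by
    intro z
    have h := NormedSpace.expSeries_div_hasSum_exp (-2 * (Real.pi : ℂ) ^ 2 * r * z.1 * z.2)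
    rw [← Complex.exp_eq_exp_ℂ] at h
    refine Eq.mp (congrArg₂ (fun f a => HasSum f a) (funext fun k => ?_) rfl) (h.mul_right (W z))
    rw [show -2 * (Real.pi : ℂ) ^ 2 * r * z.1 * z.2 = r * (-2 * Real.pi ^ 2 * z.1 * z.2) by ring,
      mul_pow, mul_div_assoc, mul_assoc]
  have hbsum : ∀ z : ℝ × ℝ, HasSum (fun k : ℕ =>
      (2 * Real.pi ^ 2 * r * |z.1| * |z.2|) ^ k / k.factorial *
        Real.exp (-Real.pi ^ 2 * (z.1 ^ 2 + z.2 ^ 2)))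
      (Real.exp (2 * Real.pi ^ 2 * r * |z.1| * |z.2|) *
        Real.exp (-Real.pi ^ 2 * (z.1 ^ 2 + z.2 ^ 2))) := by
    intro z
    have h := NormedSpace.expSeries_div_hasSum_exp (2 * Real.pi ^ 2 * r * |z.1| * |z.2|)
    rw [← Real.exp_eq_exp_ℝ] at h
    exact h.mul_right _
  have hp := Real.pi_pos
  have hbint : Integrable (fun z : ℝ × ℝ => Real.exp (2 * Real.pi ^ 2 * r * |z.1| * |z.2|) *
        Real.exp (-Real.pi ^ 2 * (z.1 ^ 2 + z.2 ^ 2))) := by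
    -- Since `2|uv| ≤ u² + v²`, the cross term uses up only a fraction `r < 1` of the Gaussian
    -- decay.
    refine (integrable_prod_gaussian (b := Real.pi ^ 2 * (1 - r))
      (mul_pos (by positivity) (by linarith))).mono' (by fun_prop) (ae_of_all _ fun z => ?_)
    rw [← Real.exp_add, Real.norm_eq_abs, Real.abs_exp, Real.exp_le_exp]
    have h2 : 2 * |z.1| * |z.2| ≤ z.1 ^ 2 + z.2 ^ 2 := by
      nlinarith [sq_nonneg (|z.1| - |z.2|), sq_abs z.1, sq_abs z.2]
    have := mul_le_mul_of_nonneg_left h2 (show 0 ≤ Real.pi ^ 2 * r by positivity)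
    nlinarith
  have hdom := hasSum_integral_of_dominated_convergence (μ := (volume : Measure (ℝ × ℝ)))
    (F := fun (k : ℕ) (z : ℝ × ℝ) =>
      (r : ℂ) ^ k * ((-2 * Real.pi ^ 2 * z.1 * z.2) ^ k / k.factorial * W z))
    (f := fun z => cexp (-2 * Real.pi ^ 2 * r * z.1 * z.2) * W z)
    (fun k z => (2 * Real.pi ^ 2 * r * |z.1| * |z.2|) ^ k / k.factorial *
        Real.exp (-Real.pi ^ 2 * (z.1 ^ 2 + z.2 ^ 2)))
    (fun k => by simp only [hW]; fun_prop)
    (fun k => ae_of_all _ fun z => (norm_mehlerTerm k x y r hr.le z).le)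
    (ae_of_all _ fun z => (hbsum z).summable)
    (by simpa only [(hbsum _).tsum_eq] using hbint)
    (ae_of_all _ hsum)
  have hint : Integrable (fun z : ℝ × ℝ => cexp (-2 * Real.pi ^ 2 * r * z.1 * z.2) * W z) := by
    refine hbint.mono' (by simp only [hW]; fun_prop) (ae_of_all _ fun z => ?_)
    rw [← (hsum z).tsum_eq, ← (hbsum z).tsum_eq]
    exact tsum_of_norm_bounded (hbsum z).summable.hasSum
      (fun k => (norm_mehlerTerm k x y r hr.le z).le)
  rw [integral_mehler hr hr1 x y hint] at hdom
  have key := hdom.mul_left ((Real.sqrt Real.pi : ℂ) * cexp ((x ^ 2 + y ^ 2) / 2))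
  rw [← Complex.hasSum_ofReal]
  refine Eq.mp (congrArg₂ (fun f a => HasSum f a) (funext fun k => ?_) ?_) key
  · rw [integral_const_mul, Complex.ofReal_mul, hermiteFun_mul_hermiteFun]
    push_cast
    ring
  · have h1 : (cexp ((x ^ 2 + y ^ 2) / 2)) = ((Real.exp ((x ^ 2 + y ^ 2) / 2) : ℝ) : ℂ) := by
      push_cast; rfl
    rw [h1, ← Complex.ofReal_mul, ← Complex.ofReal_mul]
    congr 1
    have h2 : Real.sqrt Real.pi * Real.sqrt (Real.pi)⁻¹ = 1 := by
      rw [← Real.sqrt_mul hp.le, mul_inv_cancel₀ hp.ne', Real.sqrt_one]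
    have h3 : (x ^ 2 + y ^ 2) / 2 - y ^ 2 - (x - r * y) ^ 2 / (1 - r ^ 2) =
        (x ^ 2 + y ^ 2) / 2 + (-y ^ 2 - (x - r * y) ^ 2 / (1 - r ^ 2)) := by ring
    rw [h3, Real.exp_add]
    linear_combination (Real.sqrt (Real.pi * (1 - r ^ 2))⁻¹ * Real.exp ((x ^ 2 + y ^ 2) / 2) *
      Real.exp (-y ^ 2 - (x - r * y) ^ 2 / (1 - r ^ 2))) * h2

end Mehler

/-! ### Products of series over multi-indices -/

section Product

/-- A finite product of absolutely convergent series is the sum over all multi-indices. -/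
lemma hasSum_prod_multiIndex {d : ℕ} {f : Fin d → ℕ → ℝ} {a : Fin d → ℝ}
    (hf : ∀ j, Summable fun k => ‖f j k‖) (ha : ∀ j, HasSum (f j) (a j)) :
    (Summable fun α : Fin d → ℕ => ‖∏ j, f j (α j)‖) ∧
      HasSum (fun α : Fin d → ℕ => ∏ j, f j (α j)) (∏ j, a j) := by
  -- Absolute summability is carried through the induction because multiplying two series over a
  -- product index needs it.
  induction d with
  | zero =>
    refine ⟨(hasSum_fintype _).summable, ?_⟩
    simp
  | succ d ih =>
    obtain ⟨h1, h2⟩ := ih (f := fun j => f j.succ) (a := fun j => a j.succ)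
      (fun j => hf _) (fun j => ha _)
    have e : ∀ z : ℕ × (Fin d → ℕ), ∏ j, f j ((Fin.consEquiv fun _ => ℕ) z j) =
        f 0 z.1 * ∏ j : Fin d, f j.succ (z.2 j) := by
      intro z
      rw [Fin.prod_univ_succ]
      simp [Fin.consEquiv]
    constructor
    · rw [← (Fin.consEquiv fun _ => ℕ).summable_iff]
      simp only [Function.comp_def, e]
      exact Summable.mul_norm (f := f 0) (g := fun β : Fin d → ℕ => ∏ j : Fin d, f j.succ (β j))
        (hf 0) h1
    · rw [← (Fin.consEquiv fun _ => ℕ).hasSum_iff]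
      simp only [Function.comp_def, e]
      rw [Fin.prod_univ_succ]
      exact HasSum.mul (f := f 0) (g := fun β : Fin d → ℕ => ∏ j : Fin d, f j.succ (β j)) (ha 0) h2
        (summable_mul_of_summable_norm (f := f 0)
          (g := fun β : Fin d → ℕ => ∏ j : Fin d, f j.succ (β j)) (hf 0) h1)

end Product

/-! ### The Mehler kernel and its Gaussian bounds -/

section Kernel

lemma tanh_pos {t : ℝ} (ht : 0 < t) : 0 < Real.tanh t := by
  rw [Real.tanh_eq_sinh_div_cosh]
  exact div_pos (Real.sinh_pos_iff.2 ht) (Real.cosh_pos t)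

lemma tanh_mul_one_add_exp (t : ℝ) :
    Real.tanh t * (1 + Real.exp (-2 * t)) = 1 - Real.exp (-2 * t) := by
  have h : Real.exp (-2 * t) = Real.exp (-t) * Real.exp (-t) := by rw [← Real.exp_add]; ring_nf
  have h1 : Real.exp t * Real.exp (-t) = 1 := by rw [← Real.exp_add]; simp
  have hc := (Real.cosh_pos t).ne'
  rw [Real.tanh_eq_sinh_div_cosh, div_mul_eq_mul_div, div_eq_iff hc, Real.sinh_eq, Real.cosh_eq, h]
  linear_combination Real.exp (-t) * h1

/-- This is Mehler's formula at `r = e^{-2t}`, multiplied by `√r = e^{-t}` and rewritten through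
`tanh t = (1 - r) / (1 + r)`. -/
lemma hasSum_hermite_heat {t : ℝ} (ht : 0 < t) (x y : ℝ) :
    HasSum (fun k : ℕ => Real.exp (-t * (2 * k + 1)) * (hermiteFun k x * hermiteFun k y))
      (Real.sqrt ((1 - Real.tanh t ^ 2) / (4 * Real.pi * Real.tanh t)) *
        Real.exp (-(Real.tanh t * (x + y) ^ 2 + (x - y) ^ 2 / Real.tanh t) / 4)) := by
  have hτ := tanh_pos ht
  have hrel := tanh_mul_one_add_exp t
  set τ := Real.tanh t
  set r := Real.exp (-2 * t) with hr
  have hr0 : 0 < r := Real.exp_pos _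
  have hr1 : r < 1 := Real.exp_lt_one_iff.2 (by linarith)
  have hτe : τ = (1 - r) / (1 + r) := by rw [eq_div_iff (by positivity), hrel]
  have h1r : 0 < 1 - r := by linarith
  have h1r2 : 0 < 1 - r ^ 2 := by nlinarith
  have hsq : Real.sqrt r = Real.exp (-t) := by
    rw [hr, show -2 * t = -t + -t by ring, Real.exp_add, Real.sqrt_mul_self (Real.exp_pos _).le]
  refine Eq.mp (congrArg₂ (fun f a => HasSum f a) (funext fun k => ?_) ?_)
    ((hasSum_mehler hr0 hr1 x y).mul_left (Real.sqrt r))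
  · rw [hsq, hr, ← Real.exp_nat_mul, ← mul_assoc, ← Real.exp_add]
    ring_nf
  · rw [← mul_assoc, ← Real.sqrt_mul hr0.le]
    have e1 : r * (Real.pi * (1 - r ^ 2))⁻¹ = (1 - τ ^ 2) / (4 * Real.pi * τ) := by
      rw [hτe]
      have : (1 - r ^ 2) = (1 - r) * (1 + r) := by ring
      rw [this]
      field_simp
      ring
    have e2 : (x ^ 2 + y ^ 2) / 2 - y ^ 2 - (x - r * y) ^ 2 / (1 - r ^ 2) =
        -(τ * (x + y) ^ 2 + (x - y) ^ 2 / τ) / 4 := by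
      rw [hτe]
      have : (1 - r ^ 2) = (1 - r) * (1 + r) := by ring
      rw [this]
      field_simp
      ring
    rw [e1, e2]

lemma continuous_hermiteFun (k : ℕ) : Continuous (hermiteFun k) := by
  have h : ContDiff ℝ ⊤ (fun y : ℝ => Real.exp (-y ^ 2)) := by fun_prop
  have := h.continuous_iteratedDeriv k le_top
  unfold hermiteFun
  fun_prop

variable {d : ℕ}

lemma continuous_hermitePhi (α : Fin d → ℕ) : Continuous (hermitePhi α) := by
  unfold hermitePhi
  have := continuous_hermiteFun
  fun_prop

/-- The eigenvalue of the Hermite operator on `Φ_α`. -/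
noncomputable def hermiteEigenvalue (α : Fin d → ℕ) : ℝ := 2 * ((∑ j, α j : ℕ) : ℝ) + (d : ℝ)

/-- The Mehler kernel of `e^{-tH}`. -/
noncomputable def mehlerKernel (t : ℝ) (x y : EuclideanSpace ℝ (Fin d)) : ℝ :=
  Real.sqrt ((1 - Real.tanh t ^ 2) / (4 * Real.pi * Real.tanh t)) ^ d *
    Real.exp (-(Real.tanh t * ‖x + y‖ ^ 2 + ‖x - y‖ ^ 2 / Real.tanh t) / 4)

lemma exp_eigenvalue (s : ℝ) (α : Fin d → ℕ) :
    Real.exp (s * hermiteEigenvalue α) = ∏ j, Real.exp (s * (2 * α j + 1)) := by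
  rw [← Real.exp_sum, hermiteEigenvalue, ← Finset.mul_sum, Finset.sum_add_distrib,
    ← Finset.mul_sum]
  simp

lemma summable_exp_eigenvalue {s : ℝ} (hs : 0 < s) :
    Summable fun α : Fin d → ℕ => Real.exp (-s * hermiteEigenvalue α) := by
  have h : Summable fun k : ℕ => Real.exp (-s * (2 * k + 1)) := by
    have := (summable_geometric_of_lt_one (Real.exp_pos (-2 * s)).le
      (Real.exp_lt_one_iff.2 (by linarith))).mul_left (Real.exp (-s))
    refine this.congr fun k => ?_
    rw [← Real.exp_nat_mul, ← Real.exp_add]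
    ring_nf
  simp_rw [exp_eigenvalue]
  exact (hasSum_prod_multiIndex (f := fun (_ : Fin d) (k : ℕ) => Real.exp (-s * (2 * k + 1)))
    (fun _ => h.norm) (fun _ => h.hasSum)).2.summable

lemma hasSum_mehlerKernel {t : ℝ} (ht : 0 < t) (x y : EuclideanSpace ℝ (Fin d)) :
    HasSum (fun α : Fin d → ℕ =>
        Real.exp (-t * hermiteEigenvalue α) * (hermitePhi α x * hermitePhi α y))
      (mehlerKernel t x y) := by
  have h := (hasSum_prod_multiIndex
    (f := fun (j : Fin d) (k : ℕ) => Real.exp (-t * (2 * k + 1)) *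
      (hermiteFun k (x j) * hermiteFun k (y j)))
    (fun j => (hasSum_hermite_heat ht (x j) (y j)).summable.norm)
    (fun j => hasSum_hermite_heat ht (x j) (y j))).2
  refine Eq.mp (congrArg₂ (fun f a => HasSum f a) (funext fun α => ?_) ?_) h
  · rw [Finset.prod_mul_distrib, Finset.prod_mul_distrib, exp_eigenvalue]
    rfl
  · rw [Finset.prod_mul_distrib, mehlerKernel, ← Real.exp_sum, Finset.prod_const, Finset.card_univ,
      Fintype.card_fin, EuclideanSpace.real_norm_sq_eq, EuclideanSpace.real_norm_sq_eq]
    congr 2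
    simp only [PiLp.add_apply, PiLp.sub_apply, Finset.mul_sum, Finset.sum_div,
      ← Finset.sum_add_distrib, ← Finset.sum_neg_distrib]

lemma mehlerKernel_nonneg (t : ℝ) (x y : EuclideanSpace ℝ (Fin d)) : 0 ≤ mehlerKernel t x y := by
  unfold mehlerKernel; positivity

lemma continuous_mehlerKernel (t : ℝ) :
    Continuous fun z : EuclideanSpace ℝ (Fin d) × EuclideanSpace ℝ (Fin d) =>
      mehlerKernel t z.1 z.2 := by
  unfold mehlerKernel; fun_prop

lemma mehlerKernel_comm (t : ℝ) (x y : EuclideanSpace ℝ (Fin d)) :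
    mehlerKernel t x y = mehlerKernel t y x := by
  rw [mehlerKernel, mehlerKernel, add_comm x, norm_sub_rev]

/-- Half of the decay in `x - y` is kept. As `τ < 1`, the other half dominates `τ‖x - y‖² / 8`,
which together with half of the `x + y` term gives `τ(‖x‖² + ‖y‖²) / 4` by the parallelogram law. -/
lemma mehlerKernel_le {t : ℝ} (ht : 0 < t) (x y : EuclideanSpace ℝ (Fin d)) :
    mehlerKernel t x y ≤ Real.sqrt (4 * Real.pi * Real.tanh t)⁻¹ ^ d *
      (Real.exp (-(Real.tanh t / 4) * ‖x‖ ^ 2) *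
        Real.exp (-(1 / (8 * Real.tanh t)) * ‖y - x‖ ^ 2)) := by
  have hτ := tanh_pos ht
  have hτ1 : Real.tanh t < 1 := Real.tanh_lt_one t
  unfold mehlerKernel
  set τ := Real.tanh t
  gcongr ?_ ^ d * ?_
  · apply Real.sqrt_le_sqrt
    rw [div_eq_mul_inv]
    exact mul_le_of_le_one_left (by have := Real.pi_pos; positivity) (by nlinarith)
  · rw [← Real.exp_add, Real.exp_le_exp, norm_sub_rev y x]
    have hpar := parallelogram_law_with_norm ℝ x y
    have h1 : τ * ‖x - y‖ ^ 2 ≤ ‖x - y‖ ^ 2 / τ := by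
      rw [le_div_iff₀ hτ]
      have : τ * τ ≤ 1 := by nlinarith
      nlinarith [sq_nonneg ‖x - y‖]
    have h2 : 1 / (8 * τ) * ‖x - y‖ ^ 2 = ‖x - y‖ ^ 2 / τ / 8 := by field_simp
    have h3 : τ * ‖x + y‖ ^ 2 + τ * ‖x - y‖ ^ 2 = 2 * (τ * ‖x‖ ^ 2 + τ * ‖y‖ ^ 2) := by
      linear_combination τ * hpar
    have h4 : 0 ≤ τ * ‖y‖ ^ 2 := by positivity
    have h5 : 0 ≤ τ * ‖x + y‖ ^ 2 := by positivity
    nlinarith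

/-- On the diagonal the kernel series has nonnegative terms, so each is at most the kernel itself;
take square roots. -/
lemma abs_hermitePhi_le {s : ℝ} (hs : 0 < s) (α : Fin d → ℕ) (x : EuclideanSpace ℝ (Fin d)) :
    |hermitePhi α x| ≤ Real.exp (s / 2 * hermiteEigenvalue α) *
      (Real.sqrt (Real.sqrt (4 * Real.pi * Real.tanh s)⁻¹ ^ d) *
        Real.exp (-(Real.tanh s / 8) * ‖x‖ ^ 2)) := by
  have h := hasSum_mehlerKernel hs x x
  have h1 := (le_hasSum h α fun β _ => mul_nonneg (Real.exp_pos _).le (mul_self_nonneg _)).trans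
    (mehlerKernel_le hs x x)
  simp only [sub_self, norm_zero, ne_eq, OfNat.ofNat_ne_zero, not_false_eq_true, zero_pow,
    mul_zero, Real.exp_zero, mul_one] at h1
  set P := Real.sqrt (4 * Real.pi * Real.tanh s)⁻¹ ^ d
  have hP : 0 ≤ P := by positivity
  rw [← Real.sqrt_mul_self_eq_abs]
  apply Real.sqrt_le_iff.2
  refine ⟨by positivity, ?_⟩
  have e1 : Real.exp (s / 2 * hermiteEigenvalue α) ^ 2 = Real.exp (s * hermiteEigenvalue α) := by
    rw [← Real.exp_nat_mul]; push_cast; ring_nf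
  have e2 : Real.exp (-(Real.tanh s / 8) * ‖x‖ ^ 2) ^ 2 =
      Real.exp (-(Real.tanh s / 4) * ‖x‖ ^ 2) := by
    rw [← Real.exp_nat_mul]; push_cast; ring_nf
  rw [mul_pow, mul_pow, Real.sq_sqrt hP, e1, e2]
  have e3 : Real.exp (s * hermiteEigenvalue α) * Real.exp (-s * hermiteEigenvalue α) = 1 := by
    rw [← Real.exp_add]; simp
  calc hermitePhi α x * hermitePhi α x
      = Real.exp (s * hermiteEigenvalue α) *
          (Real.exp (-s * hermiteEigenvalue α) * (hermitePhi α x * hermitePhi α x)) := by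
        rw [← mul_assoc, e3, one_mul]
    _ ≤ _ := by gcongr

end Kernel

/-! ### Interpolation for symmetric nonnegative kernels -/

section Interpolation

variable {X : Type*} [MeasurableSpace X] {μ : Measure X}

/-- In the application `a = 1/p`, `k(x) = ∫ K(x,y) dy`, `ψ(x) = ∫ K(x,y) |f(y)|^p dy` and `F = ∫
|f|^p`; Hölder in `y` bounds the operator pointwise by `k^{1-a} ψ^a`. -/
lemma eLpNorm_rpow_mul_rpow_le {k ψ : X → ℝ≥0∞} (hk : AEMeasurable k μ)
    {a : ℝ} (ha0 : 0 ≤ a) (ha1 : a ≤ 1) {A N F : ℝ≥0∞}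
    (hkA : ∀ x, k x ≤ A) (hkN : ∫⁻ x, k x ∂μ ≤ A * N)
    (hψ : AEMeasurable ψ μ) (hψN : ∀ x, ψ x ≤ A * N * F) (hψA : ∫⁻ x, ψ x ∂μ ≤ A * F)
    {q : ℝ≥0∞} (hq : 1 ≤ q) :
    eLpNorm (fun x => k x ^ (1 - a) * ψ x ^ a) q μ ≤
      A * N ^ |(1 / q).toReal - a| * F ^ a := by
  have ha1' : 0 ≤ 1 - a := by linarith
  rcases eq_or_ne q ⊤ with rfl | hqt
  · rw [eLpNorm_exponent_top]
    refine eLpNormEssSup_le_of_ae_enorm_bound (ae_of_all _ fun x => ?_)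
    rw [enorm_eq_self]
    calc k x ^ (1 - a) * ψ x ^ a ≤ A ^ (1 - a) * (A * N * F) ^ a := by
          gcongr
          · exact hkA x
          · exact hψN x
      _ = A ^ (1 - a) * A ^ a * N ^ a * F ^ a := by
          rw [ENNReal.mul_rpow_of_nonneg _ _ ha0, ENNReal.mul_rpow_of_nonneg _ _ ha0]; ring
      _ = A * N ^ |(1 / (⊤ : ℝ≥0∞)).toReal - a| * F ^ a := by
          rw [← ENNReal.rpow_add_of_nonneg _ _ ha1' ha0]
          simp [abs_of_nonneg ha0]
  have hq0 : q ≠ 0 := (zero_lt_one.trans_le hq).ne'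
  rw [eLpNorm_eq_lintegral_rpow_enorm_toReal hq0 hqt]
  have hQ : (1 / q).toReal = 1 / q.toReal := by simp
  have hQ1 : 1 ≤ q.toReal := by
    rw [← ENNReal.toReal_one]; exact ENNReal.toReal_mono hqt hq
  rw [hQ]
  set Q := q.toReal
  have hQ0 : 0 < Q := by linarith
  have haQ : 0 ≤ a * Q := by positivity
  have haQ' : 0 ≤ (1 - a) * Q := by positivity
  have e : ∀ x, ‖k x ^ (1 - a) * ψ x ^ a‖ₑ ^ Q = k x ^ ((1 - a) * Q) * ψ x ^ (a * Q) := by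
    intro x
    rw [enorm_eq_self, ENNReal.mul_rpow_of_nonneg _ _ hQ0.le, ← ENNReal.rpow_mul,
      ← ENNReal.rpow_mul]
  simp_rw [e]
  suffices h : ∫⁻ x, k x ^ ((1 - a) * Q) * ψ x ^ (a * Q) ∂μ ≤
      A ^ Q * N ^ |1 - a * Q| * F ^ (a * Q) by
    calc (∫⁻ x, k x ^ ((1 - a) * Q) * ψ x ^ (a * Q) ∂μ) ^ (1 / Q)
        ≤ (A ^ Q * N ^ |1 - a * Q| * F ^ (a * Q)) ^ (1 / Q) := by gcongr
      _ = A * N ^ |1 / Q - a| * F ^ a := by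
        have h1 : |1 - a * Q| * (1 / Q) = |1 / Q - a| := by
          rw [← abs_of_pos (show 0 < 1 / Q by positivity), ← abs_mul,
            abs_of_pos (show 0 < 1 / Q by positivity)]
          congr 1; field_simp
        rw [ENNReal.mul_rpow_of_nonneg _ _ (by positivity),
          ENNReal.mul_rpow_of_nonneg _ _ (by positivity), ← ENNReal.rpow_mul, ← ENNReal.rpow_mul,
          ← ENNReal.rpow_mul, h1, mul_one_div_cancel hQ0.ne', ENNReal.rpow_one, mul_assoc a,
          mul_one_div_cancel hQ0.ne', mul_one]
  -- If `aQ ≥ 1` (that is, `q ≥ p`), all but one power of `ψ` is bounded by its supremum. If `aQ <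
  -- 1`, Hölder with weights `1 - aQ` and `aQ` separates `k` from `ψ`.
  rcases le_or_gt 1 (a * Q) with h1 | h1
  · have h1' : 0 ≤ a * Q - 1 := by linarith
    calc ∫⁻ x, k x ^ ((1 - a) * Q) * ψ x ^ (a * Q) ∂μ
        ≤ ∫⁻ x, A ^ ((1 - a) * Q) * (A * N * F) ^ (a * Q - 1) * ψ x ∂μ := by
          refine lintegral_mono fun x => ?_
          have h2 : ψ x ^ (a * Q) = ψ x ^ (a * Q - 1) * ψ x := by
            conv_rhs => rw [← ENNReal.rpow_one (ψ x), ← ENNReal.rpow_mul, one_mul]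
            rw [← ENNReal.rpow_add_of_nonneg _ _ h1' zero_le_one, sub_add_cancel]
          simp only
          rw [h2, ← mul_assoc]
          gcongr
          · exact hkA x
          · exact hψN x
      _ = A ^ ((1 - a) * Q) * (A * N * F) ^ (a * Q - 1) * ∫⁻ x, ψ x ∂μ :=
          lintegral_const_mul'' _ hψ
      _ ≤ A ^ ((1 - a) * Q) * (A * N * F) ^ (a * Q - 1) * (A * F) := by gcongr
      _ = (A ^ ((1 - a) * Q) * A ^ (a * Q - 1) * A ^ (1 : ℝ)) * N ^ (a * Q - 1) *
            (F ^ (a * Q - 1) * F ^ (1 : ℝ)) := by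
          rw [ENNReal.mul_rpow_of_nonneg _ _ h1', ENNReal.mul_rpow_of_nonneg _ _ h1',
            ENNReal.rpow_one, ENNReal.rpow_one]
          ring
      _ = A ^ Q * N ^ |1 - a * Q| * F ^ (a * Q) := by
          rw [← ENNReal.rpow_add_of_nonneg _ _ haQ' h1',
            ← ENNReal.rpow_add_of_nonneg _ _ (by positivity) zero_le_one,
            ← ENNReal.rpow_add_of_nonneg _ _ h1' zero_le_one, abs_sub_comm, abs_of_nonneg h1']
          congr 2 <;> [congr 2; skip] <;> [ring; ring]
  · have h1' : 0 < 1 - a * Q := by linarith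
    -- The power of `k` that Hölder produces. It is at least `1` exactly because `Q ≥ 1`, so `k^c ≤
    -- A^{c-1} k`.
    set c := (1 - a) * Q / (1 - a * Q) with hc
    have hc1 : 1 ≤ c := by rw [hc, le_div_iff₀ h1']; linarith
    have hc1' : 0 ≤ c - 1 := by linarith
    have hcm : c * (1 - a * Q) = (1 - a) * Q := by rw [hc]; field_simp
    have hkc : ∫⁻ x, k x ^ c ∂μ ≤ A ^ c * N := by
      calc ∫⁻ x, k x ^ c ∂μ ≤ ∫⁻ x, A ^ (c - 1) * k x ∂μ := by
            refine lintegral_mono fun x => ?_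
            have h2 : k x ^ c = k x ^ (c - 1) * k x := by
              conv_rhs => rw [← ENNReal.rpow_one (k x), ← ENNReal.rpow_mul, one_mul]
              rw [← ENNReal.rpow_add_of_nonneg _ _ hc1' zero_le_one, sub_add_cancel]
            simp only
            rw [h2]
            gcongr
            exact hkA x
        _ = A ^ (c - 1) * ∫⁻ x, k x ∂μ := lintegral_const_mul'' _ hk
        _ ≤ A ^ (c - 1) * (A * N) := by gcongr
        _ = A ^ (c - 1) * A ^ (1 : ℝ) * N := by rw [ENNReal.rpow_one]; ring
        _ = A ^ c * N := by
            rw [← ENNReal.rpow_add_of_nonneg _ _ hc1' zero_le_one, sub_add_cancel]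
    calc ∫⁻ x, k x ^ ((1 - a) * Q) * ψ x ^ (a * Q) ∂μ
        = ∫⁻ x, (k x ^ c) ^ (1 - a * Q) * ψ x ^ (a * Q) ∂μ := by
          simp_rw [← ENNReal.rpow_mul, hcm]
      _ ≤ (∫⁻ x, k x ^ c ∂μ) ^ (1 - a * Q) * (∫⁻ x, ψ x ∂μ) ^ (a * Q) :=
          ENNReal.lintegral_mul_norm_pow_le (hk.pow_const _) hψ h1'.le haQ (by ring)
      _ ≤ (A ^ c * N) ^ (1 - a * Q) * (A * F) ^ (a * Q) := by gcongr
      _ = (A ^ ((1 - a) * Q) * A ^ (a * Q)) * N ^ (1 - a * Q) * F ^ (a * Q) := by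
          rw [ENNReal.mul_rpow_of_nonneg _ _ h1'.le, ENNReal.mul_rpow_of_nonneg _ _ haQ,
            ← ENNReal.rpow_mul, hcm]
          ring
      _ = A ^ Q * N ^ |1 - a * Q| * F ^ (a * Q) := by
          rw [← ENNReal.rpow_add_of_nonneg _ _ haQ' haQ, abs_of_pos h1']
          congr 3; ring

/-- Bounds for the operator with a symmetric nonnegative kernel `K`, in terms of the sup norm, the
iterated integral, and the total integral of `K`. -/
theorem eLpNorm_le_of_enorm_le_lintegral_kernel [SFinite μ] {E E' : Type*} [NormedAddCommGroup E]
    [NormedAddCommGroup E'] {K : X → X → ℝ≥0∞}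
    (hK : Measurable (Function.uncurry K)) (hsymm : ∀ x y, K x y = K y x) {A N : ℝ≥0∞}
    (hKA : ∀ x, ∫⁻ y, K x y ∂μ ≤ A) (hKAN : ∫⁻ x, ∫⁻ y, K x y ∂μ ∂μ ≤ A * N)
    (hKN : ∀ x y, K x y ≤ A * N) {p q : ℝ≥0∞} (hp : 1 ≤ p) (hq : 1 ≤ q) {f : X → E}
    (hf : MemLp f p μ) {g : X → E'} (hg : ∀ x, ‖g x‖ₑ ≤ ∫⁻ y, K x y * ‖f y‖ₑ ∂μ) :
    eLpNorm g q μ ≤ A * N ^ |(1 / q).toReal - (1 / p).toReal| * eLpNorm f p μ := by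
  have hkm : Measurable fun x => ∫⁻ y, K x y ∂μ := hK.lintegral_prod_right'
  have hKx : ∀ x, Measurable (K x) := fun x => hK.of_uncurry_left
  rcases eq_or_ne p ⊤ with rfl | hpt
  -- For `p = ∞` the sup norm of `f` factors out, and the previous lemma applies with `a = 0`; then
  -- `ψ` and `F` may be `0`, since `0 ^ 0 = 1`.
  · have hMt : eLpNorm f ⊤ μ ≠ ⊤ := hf.2.ne
    have h1 : ∀ x, ‖g x‖ₑ ≤ (eLpNorm f ⊤ μ).toNNReal *
        ‖(∫⁻ y, K x y ∂μ) ^ (1 - (0 : ℝ)) * (fun _ : X => (0 : ℝ≥0∞)) x ^ (0 : ℝ)‖ₑ := by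
      intro x
      rw [ENNReal.coe_toNNReal hMt, enorm_eq_self]
      simp only [sub_zero, ENNReal.rpow_one, ENNReal.rpow_zero, mul_one]
      rw [← lintegral_const_mul _ (hKx x)]
      refine (hg x).trans (lintegral_mono_ae ?_)
      filter_upwards [enorm_ae_le_eLpNormEssSup f μ] with y hy
      rw [mul_comm, eLpNorm_exponent_top]
      gcongr
    have h2 := eLpNorm_le_mul_eLpNorm_of_ae_le_mul' (ae_of_all μ h1) q
    refine h2.trans ?_
    rw [ENNReal.coe_toNNReal hMt, mul_comm]
    have h3 := eLpNorm_rpow_mul_rpow_le (μ := μ) (ψ := fun _ => 0) (F := 0) hkm.aemeasurable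
      le_rfl zero_le_one hKA hKAN aemeasurable_const (by simp) (by simp) hq
    gcongr
    simpa using h3
  have hp0 : p ≠ 0 := (zero_lt_one.trans_le hp).ne'
  have hP1 : 1 ≤ p.toReal := by
    rw [← ENNReal.toReal_one]; exact ENNReal.toReal_mono hpt hp
  have ha : (1 / p).toReal = 1 / p.toReal := by simp
  rw [eLpNorm_eq_lintegral_rpow_enorm_toReal hp0 hpt, ha]
  set P := p.toReal
  have hP0 : 0 < P := by linarith
  have ha0 : 0 ≤ 1 / P := by positivity
  have ha1 : 1 / P ≤ 1 := by rw [div_le_one hP0]; exact hP1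
  set F := ∫⁻ y, ‖f y‖ₑ ^ P ∂μ
  have hfm : AEMeasurable (fun y => ‖f y‖ₑ ^ P) μ := hf.1.enorm.pow_const _
  have hKf : AEMeasurable (Function.uncurry fun x y => K x y * ‖f y‖ₑ ^ P) (μ.prod μ) :=
    hK.aemeasurable.mul hfm.comp_snd
  have hψm : AEMeasurable (fun x => ∫⁻ y, K x y * ‖f y‖ₑ ^ P ∂μ) μ := hKf.lintegral_prod_right'
  have hψN : ∀ x, ∫⁻ y, K x y * ‖f y‖ₑ ^ P ∂μ ≤ A * N * F := by
    intro x
    rw [← lintegral_const_mul'' _ hfm]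
    exact lintegral_mono fun y => by gcongr; exact hKN x y
  -- Tonelli calls for the integral of `K` in its first variable; symmetry reduces it to `hKA`.
  have hψA : ∫⁻ x, ∫⁻ y, K x y * ‖f y‖ₑ ^ P ∂μ ∂μ ≤ A * F := by
    rw [lintegral_lintegral_swap hKf, ← lintegral_const_mul'' _ hfm]
    refine lintegral_mono fun y => ?_
    simp only [hsymm _ y]
    rw [lintegral_mul_const _ (hKx y)]
    gcongr
    exact hKA y
  refine le_trans (eLpNorm_mono_enorm fun x => ?_)
    (eLpNorm_rpow_mul_rpow_le hkm.aemeasurable ha0 ha1 hKA hKAN hψm hψN hψA hq)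
  rw [enorm_eq_self]
  refine (hg x).trans (le_trans (le_of_eq ?_) (ENNReal.lintegral_mul_norm_pow_le
    (hKx x).aemeasurable ((hKx x).aemeasurable.mul hfm) (by linarith) ha0 (by ring)))
  refine lintegral_congr fun y => ?_
  rw [Pi.mul_apply, ENNReal.mul_rpow_of_nonneg _ _ ha0, ← ENNReal.rpow_mul,
    mul_one_div_cancel hP0.ne', ENNReal.rpow_one, ← mul_assoc,
    ← ENNReal.rpow_add_of_nonneg _ _ (by linarith) ha0, sub_add_cancel, ENNReal.rpow_one]

end Interpolation

/-! ### Gaussian integrals and norms -/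

section Gaussian

variable {d : ℕ}

lemma integrable_gaussian {b : ℝ} (hb : 0 < b) :
    Integrable fun x : EuclideanSpace ℝ (Fin d) => Real.exp (-b * ‖x‖ ^ 2) := by
  -- A non-integrable function has Bochner integral `0`, but the Gaussian formula gives a positive
  -- value.
  by_contra h
  have h1 := GaussianFourier.integral_rexp_neg_mul_sq_norm (V := EuclideanSpace ℝ (Fin d)) hb
  rw [integral_undef h] at h1
  have : 0 < (Real.pi / b) ^ (Module.finrank ℝ (EuclideanSpace ℝ (Fin d)) / 2 : ℝ) :=
    Real.rpow_pos_of_pos (div_pos Real.pi_pos hb) _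
  exact this.ne h1

lemma lintegral_gaussian {b : ℝ} (hb : 0 < b) :
    ∫⁻ x : EuclideanSpace ℝ (Fin d), ENNReal.ofReal (Real.exp (-b * ‖x‖ ^ 2)) =
      ENNReal.ofReal (Real.sqrt (Real.pi / b) ^ d) := by
  rw [← ofReal_integral_eq_lintegral_ofReal (integrable_gaussian hb)
    (ae_of_all _ fun x => (Real.exp_pos _).le), GaussianFourier.integral_rexp_neg_mul_sq_norm hb,
    Real.sqrt_eq_rpow, ← Real.rpow_mul_natCast (div_pos Real.pi_pos hb).le]
  congr 2
  simp
  ring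

/-- A bounded integrable function lies in every `L^q`: this is the case `a = 0` of
`eLpNorm_rpow_mul_rpow_le`. -/
lemma memLp_gaussian {b : ℝ} (hb : 0 < b) {q : ℝ≥0∞} (hq : 1 ≤ q) :
    MemLp (fun x : EuclideanSpace ℝ (Fin d) => Real.exp (-b * ‖x‖ ^ 2)) q := by
  refine ⟨by fun_prop, ?_⟩
  have h := eLpNorm_rpow_mul_rpow_le (μ := volume)
    (k := fun x : EuclideanSpace ℝ (Fin d) => ENNReal.ofReal (Real.exp (-b * ‖x‖ ^ 2)))
    (ψ := fun _ => 0) (A := 1) (N := ENNReal.ofReal (Real.sqrt (Real.pi / b) ^ d)) (F := 0)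
    (by fun_prop) le_rfl zero_le_one
    (fun x => by
      rw [ENNReal.ofReal_le_one, Real.exp_le_one_iff]
      nlinarith [sq_nonneg ‖x‖])
    (by rw [one_mul, lintegral_gaussian hb]) aemeasurable_const (by simp) (by simp) hq
  refine lt_of_le_of_lt ((eLpNorm_mono_enorm fun x => ?_).trans h) ?_
  · rw [enorm_eq_self, Real.enorm_eq_ofReal (Real.exp_pos _).le]
    simp
  · simp only [one_mul, ENNReal.rpow_zero, mul_one]
    exact ENNReal.rpow_lt_top_of_nonneg (abs_nonneg _) ENNReal.ofReal_ne_top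

end Gaussian

/-! ### The three kernel bounds -/

section KernelBounds

variable {d : ℕ}

lemma sqrt_inv_pow_eq_rpow {τ : ℝ} (hτ : 0 < τ) (d : ℕ) :
    Real.sqrt τ⁻¹ ^ d = τ ^ (-((d : ℝ) / 2)) := by
  rw [Real.sqrt_eq_rpow, ← Real.rpow_mul_natCast (by positivity), Real.inv_rpow hτ.le,
    ← Real.rpow_neg hτ.le]
  congr 1; ring

lemma lintegral_mehlerKernel_le {t : ℝ} (ht : 0 < t) (x : EuclideanSpace ℝ (Fin d)) :
    ∫⁻ y, ENNReal.ofReal (mehlerKernel t x y) ≤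
      ENNReal.ofReal (Real.sqrt 2 ^ d) *
        ENNReal.ofReal (Real.exp (-(Real.tanh t / 4) * ‖x‖ ^ 2)) := by
  have hτ := tanh_pos ht
  have hb : 0 < 1 / (8 * Real.tanh t) := by positivity
  calc ∫⁻ y, ENNReal.ofReal (mehlerKernel t x y)
      ≤ ∫⁻ y, ENNReal.ofReal (Real.sqrt (4 * Real.pi * Real.tanh t)⁻¹ ^ d *
          Real.exp (-(Real.tanh t / 4) * ‖x‖ ^ 2)) *
          ENNReal.ofReal (Real.exp (-(1 / (8 * Real.tanh t)) * ‖y - x‖ ^ 2)) := by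
        refine lintegral_mono fun y => ?_
        rw [← ENNReal.ofReal_mul (by positivity), mul_assoc]
        exact ENNReal.ofReal_le_ofReal (mehlerKernel_le ht x y)
    _ = ENNReal.ofReal (Real.sqrt (4 * Real.pi * Real.tanh t)⁻¹ ^ d *
          Real.exp (-(Real.tanh t / 4) * ‖x‖ ^ 2)) *
          ENNReal.ofReal (Real.sqrt (Real.pi / (1 / (8 * Real.tanh t))) ^ d) := by
        rw [lintegral_const_mul _ (by fun_prop), lintegral_sub_right_eq_self
          (fun y => ENNReal.ofReal (Real.exp (-(1 / (8 * Real.tanh t)) * ‖y‖ ^ 2))) x,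
          lintegral_gaussian hb]
    _ = _ := by
        rw [← ENNReal.ofReal_mul (by positivity), ← ENNReal.ofReal_mul (by positivity),
          mul_right_comm, ← mul_pow, ← Real.sqrt_mul (by have := Real.pi_pos; positivity)]
        congr 4
        have := Real.pi_ne_zero
        field_simp
        norm_num

lemma lintegral_mehlerKernel_le_const {t : ℝ} (ht : 0 < t) (x : EuclideanSpace ℝ (Fin d)) :
    ∫⁻ y, ENNReal.ofReal (mehlerKernel t x y) ≤ ENNReal.ofReal (Real.sqrt (8 * Real.pi) ^ d) := by
  refine (lintegral_mehlerKernel_le ht x).trans ?_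
  rw [← ENNReal.ofReal_mul (by positivity)]
  apply ENNReal.ofReal_le_ofReal
  have h1 : Real.exp (-(Real.tanh t / 4) * ‖x‖ ^ 2) ≤ 1 := by
    rw [Real.exp_le_one_iff]
    nlinarith [sq_nonneg ‖x‖, tanh_pos ht]
  refine (mul_le_of_le_one_right (by positivity) h1).trans ?_
  gcongr
  linarith [Real.pi_gt_three]

/-- The constant `8π` originates here, as `2 · 4π`: `2^{d/2}` from the integral in `y` and
`(4π/τ)^{d/2}` from the one in `x`. The other two bounds are relaxed to share it. -/
lemma lintegral_lintegral_mehlerKernel_le {t : ℝ} (ht : 0 < t) :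
    ∫⁻ x : EuclideanSpace ℝ (Fin d), ∫⁻ y, ENNReal.ofReal (mehlerKernel t x y) ≤
      ENNReal.ofReal (Real.sqrt (8 * Real.pi) ^ d) *
        ENNReal.ofReal (Real.tanh t ^ (-((d : ℝ) / 2))) := by
  have hτ := tanh_pos ht
  refine (lintegral_mono fun x => lintegral_mehlerKernel_le ht x).trans ?_
  rw [lintegral_const_mul _ (by fun_prop), lintegral_gaussian (by positivity),
    ← ENNReal.ofReal_mul (by positivity), ← ENNReal.ofReal_mul (by positivity),
    ← sqrt_inv_pow_eq_rpow hτ, ← mul_pow, ← mul_pow, ← Real.sqrt_mul (by norm_num),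
    ← Real.sqrt_mul (by have := Real.pi_pos; positivity)]
  apply le_of_eq
  congr 3
  field_simp
  norm_num

lemma mehlerKernel_le_const {t : ℝ} (ht : 0 < t) (x y : EuclideanSpace ℝ (Fin d)) :
    ENNReal.ofReal (mehlerKernel t x y) ≤ ENNReal.ofReal (Real.sqrt (8 * Real.pi) ^ d) *
        ENNReal.ofReal (Real.tanh t ^ (-((d : ℝ) / 2))) := by
  have hτ := tanh_pos ht
  rw [← ENNReal.ofReal_mul (by positivity)]
  apply ENNReal.ofReal_le_ofReal
  refine (mehlerKernel_le ht x y).trans ?_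
  have h1 : Real.exp (-(Real.tanh t / 4) * ‖x‖ ^ 2) *
      Real.exp (-(1 / (8 * Real.tanh t)) * ‖y - x‖ ^ 2) ≤ 1 := by
    rw [← Real.exp_add, Real.exp_le_one_iff]
    have h2 : 0 ≤ 1 / (8 * Real.tanh t) * ‖y - x‖ ^ 2 := by positivity
    have h3 : 0 ≤ Real.tanh t / 4 * ‖x‖ ^ 2 := by positivity
    linarith
  refine (mul_le_of_le_one_right (by positivity) h1).trans ?_
  rw [← sqrt_inv_pow_eq_rpow hτ, ← mul_pow,
    ← Real.sqrt_mul (by have := Real.pi_pos; positivity)]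
  gcongr ?_ ^ d
  apply Real.sqrt_le_sqrt
  have hpi := Real.pi_gt_three
  rw [mul_inv]
  gcongr
  exact (inv_le_one_of_one_le₀ (by linarith)).trans (by linarith)

end KernelBounds

/-! ### Convergence of the expansion and the heat estimate -/

section Expansion

variable {d : ℕ}

/-- A Gaussian that dominates `exp (-(s / 2) λ_α) |Φ_α|` for all `α`. -/
noncomputable def hermiteMajorant (s : ℝ) (x : EuclideanSpace ℝ (Fin d)) : ℝ :=
  Real.sqrt (Real.sqrt (4 * Real.pi * Real.tanh s)⁻¹ ^ d) *
    Real.exp (-(Real.tanh s / 8) * ‖x‖ ^ 2)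

lemma hermiteMajorant_nonneg (s : ℝ) (x : EuclideanSpace ℝ (Fin d)) :
    0 ≤ hermiteMajorant s x := by
  unfold hermiteMajorant; positivity

lemma memLp_hermiteMajorant {s : ℝ} (hs : 0 < s) {q : ℝ≥0∞} (hq : 1 ≤ q) :
    MemLp (hermiteMajorant s : EuclideanSpace ℝ (Fin d) → ℝ) q :=
  (memLp_gaussian (by have := tanh_pos hs; positivity) hq).const_mul _

variable {p : ℝ≥0∞} {f : EuclideanSpace ℝ (Fin d) → ℂ}

lemma integrable_norm_mul_hermiteMajorant (hp : 1 ≤ p) (hf : MemLp f p) {s : ℝ} (hs : 0 < s) :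
    Integrable fun x => ‖f x‖ * hermiteMajorant s x := by
  have : p.HolderConjugate p.conjExponent := ENNReal.HolderConjugate.conjExponent hp
  exact hf.norm.integrable_mul (q := p.conjExponent)
    (memLp_hermiteMajorant hs (by unfold ENNReal.conjExponent; exact le_self_add))

lemma norm_mul_hermitePhi_le {s : ℝ} (hs : 0 < s) (α : Fin d → ℕ)
    (x : EuclideanSpace ℝ (Fin d)) :
    ‖f x * (hermitePhi α x : ℂ)‖ ≤
      Real.exp (s / 2 * hermiteEigenvalue α) * (‖f x‖ * hermiteMajorant s x) := by
  rw [norm_mul, Complex.norm_real, Real.norm_eq_abs, mul_left_comm]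
  gcongr
  exact abs_hermitePhi_le hs α x

lemma integrable_mul_hermitePhi (hp : 1 ≤ p) (hf : MemLp f p) (α : Fin d → ℕ) :
    Integrable fun x => f x * (hermitePhi α x : ℂ) := by
  refine ((integrable_norm_mul_hermiteMajorant hp hf one_pos).const_mul
    (Real.exp (1 / 2 * hermiteEigenvalue α))).mono' (hf.1.mul ?_)
    (ae_of_all _ fun x => norm_mul_hermitePhi_le one_pos α x)
  exact (Complex.continuous_ofReal.comp (continuous_hermitePhi α)).aestronglyMeasurable

lemma integral_norm_mul_hermitePhi_le (hp : 1 ≤ p) (hf : MemLp f p) {s : ℝ} (hs : 0 < s)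
    (α : Fin d → ℕ) :
    ∫ x, ‖f x * (hermitePhi α x : ℂ)‖ ≤
      Real.exp (s / 2 * hermiteEigenvalue α) * ∫ x, ‖f x‖ * hermiteMajorant s x := by
  rw [← integral_const_mul]
  exact integral_mono (integrable_mul_hermitePhi hp hf α).norm
    ((integrable_norm_mul_hermiteMajorant hp hf hs).const_mul _)
    fun x => norm_mul_hermitePhi_le hs α x

/-- Using the majorant at time `t/2`, the coefficient and `Φ_α(x)` each cost `e^{tλ/4}`. Half of the
factor `e^{-tλ}` survives, which is summable in `α`. -/
lemma exp_mul_integral_norm_mul_abs_le (hp : 1 ≤ p) (hf : MemLp f p) {t : ℝ} (ht : 0 < t)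
    (α : Fin d → ℕ) (x : EuclideanSpace ℝ (Fin d)) :
    Real.exp (-t * hermiteEigenvalue α) * (∫ y, ‖f y * (hermitePhi α y : ℂ)‖) *
        |hermitePhi α x| ≤
      Real.exp (-(t / 2) * hermiteEigenvalue α) *
        ((∫ y, ‖f y‖ * hermiteMajorant (t / 2) y) * hermiteMajorant (t / 2) x) := by
  have hs : 0 < t / 2 := by linarith
  calc _ ≤ Real.exp (-t * hermiteEigenvalue α) *
        (Real.exp (t / 2 / 2 * hermiteEigenvalue α) *
          ∫ y, ‖f y‖ * hermiteMajorant (t / 2) y) *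
        (Real.exp (t / 2 / 2 * hermiteEigenvalue α) * hermiteMajorant (t / 2) x) := by
        gcongr
        · exact mul_nonneg (Real.exp_pos _).le (mul_nonneg (Real.exp_pos _).le
            (integral_nonneg fun y => mul_nonneg (norm_nonneg _) (hermiteMajorant_nonneg _ _)))
        · exact integral_norm_mul_hermitePhi_le hp hf hs α
        · exact abs_hermitePhi_le hs α x
    _ = (Real.exp (-t * hermiteEigenvalue α) * Real.exp (t / 2 / 2 * hermiteEigenvalue α) *
          Real.exp (t / 2 / 2 * hermiteEigenvalue α)) *
        ((∫ y, ‖f y‖ * hermiteMajorant (t / 2) y) * hermiteMajorant (t / 2) x) := by ring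
    _ = _ := by
        rw [← Real.exp_add, ← Real.exp_add]
        congr 2; ring

lemma norm_hermiteHeatTerm_le (hp : 1 ≤ p) (hf : MemLp f p) {t : ℝ} (ht : 0 < t)
    (α : Fin d → ℕ) (x : EuclideanSpace ℝ (Fin d)) :
    ‖hermiteHeatTerm t f α x‖ ≤ Real.exp (-(t / 2) * hermiteEigenvalue α) *
        ((∫ y, ‖f y‖ * hermiteMajorant (t / 2) y) * hermiteMajorant (t / 2) x) := by
  refine le_trans ?_ (exp_mul_integral_norm_mul_abs_le hp hf ht α x)
  rw [hermiteHeatTerm, norm_mul, norm_mul, Complex.norm_real, Complex.norm_real,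
    Real.norm_eq_abs, Real.norm_eq_abs, Real.abs_exp]
  exact mul_le_mul_of_nonneg_right (mul_le_mul_of_nonneg_left
    (norm_integral_le_integral_norm _) (Real.exp_pos _).le) (abs_nonneg _)

lemma summable_norm_hermiteHeatTerm (hp : 1 ≤ p) (hf : MemLp f p) {t : ℝ} (ht : 0 < t)
    (x : EuclideanSpace ℝ (Fin d)) : Summable fun α => ‖hermiteHeatTerm t f α x‖ :=
  Summable.of_nonneg_of_le (fun _ => norm_nonneg _) (norm_hermiteHeatTerm_le hp hf ht · x)
    ((summable_exp_eigenvalue (half_pos ht)).mul_right _)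

/-- The spectral expansion of `e^{-tH} f` agrees with the integral against Mehler's kernel. -/
lemma hermiteHeat_eq_integral (hp : 1 ≤ p) (hf : MemLp f p) {t : ℝ} (ht : 0 < t)
    (x : EuclideanSpace ℝ (Fin d)) :
    hermiteHeat t f x = ∫ y, (mehlerKernel t x y : ℂ) * f y := by
  have hterm : ∀ α : Fin d → ℕ, hermiteHeatTerm t f α x =
      ∫ y, ((Real.exp (-t * hermiteEigenvalue α) * hermitePhi α x : ℝ) : ℂ) *
        (f y * (hermitePhi α y : ℂ)) := by
    intro α
    rw [integral_const_mul, Complex.ofReal_mul, mul_right_comm]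
    rfl
  -- Sum and integral may be exchanged because the integrals of the norms are summable.
  have h := hasSum_integral_of_summable_integral_norm (μ := volume)
    (F := fun (α : Fin d → ℕ) y =>
      ((Real.exp (-t * hermiteEigenvalue α) * hermitePhi α x : ℝ) : ℂ) *
        (f y * (hermitePhi α y : ℂ)))
    (fun α => (integrable_mul_hermitePhi hp hf α).const_mul _)
    (by
      refine Summable.of_nonneg_of_le (fun α => integral_nonneg fun y => norm_nonneg _)
        (fun α => ?_) ((summable_exp_eigenvalue (half_pos ht)).mul_right
          ((∫ y, ‖f y‖ * hermiteMajorant (t / 2) y) * hermiteMajorant (t / 2) x))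
      refine le_trans (le_of_eq ?_) (exp_mul_integral_norm_mul_abs_le hp hf ht α x)
      simp_rw [norm_mul ((Real.exp (-t * hermiteEigenvalue α) * hermitePhi α x : ℝ) : ℂ)]
      rw [integral_const_mul, Complex.norm_real, Real.norm_eq_abs, abs_mul, Real.abs_exp,
        mul_right_comm])
  simp_rw [hermiteHeat, hterm]
  rw [h.tsum_eq]
  refine integral_congr_ae (ae_of_all _ fun y => ?_)
  have h2 := (Complex.hasSum_ofReal.2 (hasSum_mehlerKernel ht x y)).mul_right (f y)
  refine Eq.trans ?_ h2.tsum_eq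
  refine tsum_congr fun α => ?_
  push_cast
  ring

lemma enorm_hermiteHeat_le (hp : 1 ≤ p) (hf : MemLp f p) {t : ℝ} (ht : 0 < t)
    (x : EuclideanSpace ℝ (Fin d)) :
    ‖hermiteHeat t f x‖ₑ ≤ ∫⁻ y, ENNReal.ofReal (mehlerKernel t x y) * ‖f y‖ₑ := by
  rw [hermiteHeat_eq_integral hp hf ht]
  refine (enorm_integral_le_lintegral_enorm _).trans (le_of_eq (lintegral_congr fun y => ?_))
  rw [enorm_mul]
  congr 1
  rw [← ofReal_norm, Complex.norm_real, Real.norm_of_nonneg (mehlerKernel_nonneg t x y)]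

lemma continuous_hermiteHeatTerm (t : ℝ) (f : EuclideanSpace ℝ (Fin d) → ℂ) (α : Fin d → ℕ) :
    Continuous (hermiteHeatTerm t f α) :=
  continuous_const.mul (Complex.continuous_ofReal.comp (continuous_hermitePhi α))

lemma aestronglyMeasurable_hermiteHeat (hp : 1 ≤ p) (hf : MemLp f p) {t : ℝ} (ht : 0 < t) :
    AEStronglyMeasurable (hermiteHeat t f) :=
  aestronglyMeasurable_of_tendsto_ae atTop
    (f := fun (s : Finset (Fin d → ℕ)) x => ∑ α ∈ s, hermiteHeatTerm t f α x)
    (fun s => (continuous_finsetSum s fun α _ =>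
      continuous_hermiteHeatTerm t f α).aestronglyMeasurable)
    (ae_of_all _ fun x => (summable_norm_hermiteHeatTerm hp hf ht x).of_norm.hasSum)

/-- The remainder is a numerical tail times one fixed Gaussian in `x`, so pointwise control gives
convergence in every `L^q`, `q ≥ 1`. -/
lemma norm_hermiteHeat_sub_sum_le (hp : 1 ≤ p) (hf : MemLp f p) {t : ℝ} (ht : 0 < t)
    (s : Finset (Fin d → ℕ)) (x : EuclideanSpace ℝ (Fin d)) :
    ‖hermiteHeat t f x - ∑ α ∈ s, hermiteHeatTerm t f α x‖ ≤
      (∑' α : {α // α ∉ s}, Real.exp (-(t / 2) * hermiteEigenvalue (α : Fin d → ℕ))) *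
        ‖(∫ y, ‖f y‖ * hermiteMajorant (t / 2) y) * hermiteMajorant (t / 2) x‖ := by
  have hs := (summable_norm_hermiteHeatTerm hp hf ht x).of_norm
  have he := summable_exp_eigenvalue (d := d) (half_pos ht)
  rw [hermiteHeat, ← hs.sum_add_tsum_subtype_compl s, add_sub_cancel_left]
  refine tsum_of_norm_bounded ((he.subtype _).hasSum.mul_right _) fun α => ?_
  refine (norm_hermiteHeatTerm_le hp hf ht α x).trans ?_
  exact mul_le_mul_of_nonneg_left (le_abs_self _) (Real.exp_pos _).le

lemma tendsto_eLpNorm_hermiteHeat_sub_sum (hp : 1 ≤ p) (hf : MemLp f p) {t : ℝ} (ht : 0 < t)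
    {q : ℝ≥0∞} (hq : 1 ≤ q) :
    Tendsto (fun s : Finset (Fin d → ℕ) =>
      eLpNorm (fun x => hermiteHeat t f x - ∑ α ∈ s, hermiteHeatTerm t f α x) q volume)
      atTop (𝓝 0) := by
  have hΓ : MemLp (fun x : EuclideanSpace ℝ (Fin d) =>
      (∫ y, ‖f y‖ * hermiteMajorant (t / 2) y) * hermiteMajorant (t / 2) x) q :=
    (memLp_hermiteMajorant (half_pos ht) hq).const_mul _
  have h0 := tendsto_tsum_compl_atTop_zero
    fun α : Fin d → ℕ => Real.exp (-(t / 2) * hermiteEigenvalue α)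
  have h1 := ENNReal.Tendsto.mul_const (ENNReal.tendsto_ofReal h0) (Or.inr hΓ.2.ne)
  rw [ENNReal.ofReal_zero, zero_mul] at h1
  exact tendsto_of_tendsto_of_tendsto_of_le_of_le tendsto_const_nhds h1 (fun _ => zero_le)
    fun s => eLpNorm_le_mul_eLpNorm_of_ae_le_mul
      (ae_of_all _ fun x => norm_hermiteHeat_sub_sum_le hp hf ht s x) q

lemma eLpNorm_hermiteHeat_le (hp : 1 ≤ p) (hf : MemLp f p) {t : ℝ} (ht : 0 < t)
    {q : ℝ≥0∞} (hq : 1 ≤ q) :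
    eLpNorm (hermiteHeat t f) q volume ≤
      ENNReal.ofReal (Real.sqrt (8 * Real.pi) ^ d *
        Real.tanh t ^ (-((d : ℝ) / 2) * |(1 / q).toReal - (1 / p).toReal|)) *
        eLpNorm f p volume := by
  have hτ := tanh_pos ht
  have h := eLpNorm_le_of_enorm_le_lintegral_kernel (μ := volume)
    (K := fun x y : EuclideanSpace ℝ (Fin d) => ENNReal.ofReal (mehlerKernel t x y))
    (continuous_mehlerKernel t).measurable.ennreal_ofReal
    (fun x y => by rw [mehlerKernel_comm]) (lintegral_mehlerKernel_le_const ht)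
    (lintegral_lintegral_mehlerKernel_le ht) (mehlerKernel_le_const ht) hp hq hf
    (enorm_hermiteHeat_le hp hf ht)
  rwa [ENNReal.ofReal_rpow_of_pos (by positivity), ← Real.rpow_mul hτ.le,
    ← ENNReal.ofReal_mul (by positivity)] at h

end Expansion

theorem lemma3p1 (d : ℕ) :
    ∃ C : ℝ, 0 < C ∧
      ∀ (p q : ℝ≥0∞), 1 ≤ p → 1 ≤ q → ∀ t : ℝ, 0 < t →
        ∀ f : EuclideanSpace ℝ (Fin d) → ℂ, MemLp f p volume →
          -- `e^{-tH} f` is well defined: the coefficients and the series converge absolutely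
          (∀ α : Fin d → ℕ, Integrable (fun x => f x * (hermitePhi α x : ℂ)) volume) ∧
          (∀ x, Summable (fun α : Fin d → ℕ => hermiteHeatTerm t f α x)) ∧
          -- for `f ∈ L²` it is the sum of the spectral expansion in `L²`
          (MemLp f 2 volume →
            Tendsto (fun s : Finset (Fin d → ℕ) =>
              eLpNorm (fun x => hermiteHeat t f x - ∑ α ∈ s, hermiteHeatTerm t f α x) 2 volume)
              atTop (𝓝 0)) ∧
          MemLp (hermiteHeat t f) q volume ∧
          eLpNorm (hermiteHeat t f) q volume ≤
            ENNReal.ofReal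
              (C * Real.tanh t ^ (-((d : ℝ) / 2) * |(1 / q).toReal - (1 / p).toReal|)) *
              eLpNorm f p volume := by
  refine ⟨Real.sqrt (8 * Real.pi) ^ d, by have := Real.pi_pos; positivity,
    fun p q hp hq t ht f hf => ?_⟩
  have hbound := eLpNorm_hermiteHeat_le hp hf ht hq
  exact ⟨integrable_mul_hermitePhi hp hf,
    fun x => (summable_norm_hermiteHeatTerm hp hf ht x).of_norm,
    fun _ => tendsto_eLpNorm_hermiteHeat_sub_sum hp hf ht one_le_two,
    ⟨aestronglyMeasurable_hermiteHeat hp hf ht,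
      hbound.trans_lt (ENNReal.mul_lt_top ENNReal.ofReal_lt_top hf.2)⟩, hbound⟩
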